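/- For $a\in\mathbb R$ and $n\ge 1$ let $d_a(n)=\sum_{d\mid n}d^a$, and let $\chi$ be the factor in the functional equation $\zeta(1-s)=\chi(1-s)\zeta(s)$ of the Riemann zeta function, that is, $\chi(1-s)=2(2\pi)^{-s}\cos\left(\frac{\pi s}{2}\right)\Gamma(s)$. Let $T\ge 100$, $X=\frac{T}{2\pi}$ and $\lambda=\frac{1.501}{\log T}$, and for $\frac14\le\tau\le\frac12$ put $$F_\tau(s)=\chi(1-s)\left(\zeta(s)\,\zeta(2\tau-1+s)-\sum_{n\le X}\frac{d_{1-2\tau}(n)}{n^s}\right),$$ $$J_1=\frac1{2i}\int_{1-\tau-iT}^{2-2\tau+\lambda-iT}F_\tau(s)\,ds,\qquad J_2=\frac1{2i}\int_{2-2\tau+\lambda+iT}^{1-\tau+iT}F_\tau(s)\,ds,$$ the integrals being taken along straight (horizontal) segments. If $\tau=\frac12$, then each $J\in\{J_1,J_2\}$ satisfies $$|J|\le 0.47\,\sqrt T\log^2 T+2.825\,\sqrt T\log T.$$ If $\frac14\le\tau<\frac12$, then each $J\in\{J_1,J_2\}$ satisfies $$|J|\le\left(\frac{0.173}{\left(\frac12-\tau\right)^2}+6.76\right)T^{\frac32-2\tau}\log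 T+0.1\,T^{1-\tau}\log^2 T.$$ -/

import Mathlib

noncomputable section

/-- The generalized divisor function `d_a(n) = ∑_{d ∣ n} d ^ a`, for a real exponent `a`. -/
def divisorPowSum (a : ℝ) (n : ℕ) : ℝ :=
  ∑ d ∈ n.divisors, (d : ℝ) ^ a

/-- The factor `χ` of the functional equation `ζ(1 - s) = χ(1 - s) ζ(s)`, that is
`χ(1 - s) = 2 (2π)^(-s) cos(π s / 2) Γ(s)`, written in the variable `w = 1 - s`. -/
def zetaChi (w : ℂ) : ℂ :=
  2 * (2 * (Real.pi : ℂ)) ^ (-(1 - w)) * Complex.cos ((Real.pi : ℂ) * (1 - w) / 2)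
    * Complex.Gamma (1 - w)

/-- The contour integral of `f` along the straight segment from `a` to `b`. -/
def segmentIntegral (f : ℂ → ℂ) (a b : ℂ) : ℂ :=
  (b - a) * ∫ u in (0 : ℝ)..1, f (a + (u : ℂ) * (b - a))

/-- The integrand `χ(1 - s) (ζ(s) ζ(2τ - 1 + s) - ∑_{n ≤ X} d_{1-2τ}(n) / n^s)`. -/
def integrandJ (τ X : ℝ) (s : ℂ) : ℂ :=
  zetaChi (1 - s) * (riemannZeta s * riemannZeta (2 * (τ : ℂ) - 1 + s)
    - ∑ n ∈ Finset.Icc 1 ⌊X⌋₊, (divisorPowSum (1 - 2 * τ) n : ℂ) / (n : ℂ) ^ s)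

/-- The integral over `[1 - τ - iT, 2 - 2τ + lam - iT]`, with the factor `1 / (2i)`. -/
def integralJ₁ (τ X lam T : ℝ) : ℂ :=
  1 / (2 * Complex.I) * segmentIntegral (integrandJ τ X)
    (((1 - τ : ℝ) : ℂ) - Complex.I * (T : ℂ))
    (((2 - 2 * τ + lam : ℝ) : ℂ) - Complex.I * (T : ℂ))

/-- The integral over `[2 - 2τ + lam + iT, 1 - τ + iT]`, with the factor `1 / (2i)`. -/
def integralJ₂ (τ X lam T : ℝ) : ℂ :=
  1 / (2 * Complex.I) * segmentIntegral (integrandJ τ X)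
    (((2 - 2 * τ + lam : ℝ) : ℂ) + Complex.I * (T : ℂ))
    (((1 - τ : ℝ) : ℂ) + Complex.I * (T : ℂ))

end

/-!
Write `δ = 1/2 - τ`. By the functional equation the integrand is
`ζ(1 - s) ζ(s - 2δ) - χ(1 - s) ∑_{n ≤ X} d_{2δ}(n) n ^ (-s)`, and both terms are bounded on the
whole segment by a constant close to `1` times
`M = X ^ (1/2 + 2δ + λ) (1 + 1/λ) (1 + 1/(2δ + λ))`. Half the length `1/2 + δ + λ` of the segment
times the sum of the two bounds is small enough, because `T ^ λ = exp 1.501`.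

* The product `ζ(1 - s) ζ(s - 2δ)` is invariant under `s ↦ 1 + 2δ - s`. On the edge
  `Re s = 1 + 2δ + λ` of the strip `-λ ≤ Re s ≤ 1 + 2δ + λ` it equals `χ(1 - s) ζ(s) ζ(s - 2δ)`,
  of size at most about `M`; by symmetry the other edge has the same bound, and the maximum principle
  carries it inside (`norm_riemannZeta_mul_le`). The poles are removed by two linear factors, and
  a factor `exp ((s - 1/2 - δ - i t₀)² / T)` localizes at height `t₀ = ± T`, at the cost of a
  factor `1 + O(1/T)`.
* For `n ≤ X` the quotient `(X / n) ^ σ` is nondecreasing in `σ`, so the Dirichlet polynomial may be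
  moved to `Re s = 1 + 2δ + λ`, where it is at most the product of the two zeta series
  (`norm_dirichletPoly_le`).
* The bound `|χ(1 - s)| ≤ (1 + O(1/T)) X ^ (Re s - 1/2)` needs no Stirling formula: `|χ| = 1` on the
  critical line by the reflection formula, `|χ(1 - s)|` on `Re s = 5/2` follows from the recurrence
  of `Γ`, and a localized three lines argument interpolates (`norm_zetaChi_le`).
-/

section

open Complex Set Filter MeasureTheory
open scoped Real Topology

/-! ### Phragmén–Lindelöf in a strip -/

/-- Phragmén–Lindelöf in a vertical strip, for functions of at most exponential growth. -/
theorem norm_le_of_verticalStrip {f : ℂ → ℂ} {a b k K C : ℝ} (hab : a < b) (hk : 0 ≤ k)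
    (hf : DiffContOnCl ℂ f (re ⁻¹' Ioo a b))
    (hgrowth : ∀ z : ℂ, z.re ∈ Ioo a b → 1 ≤ |z.im| → ‖f z‖ ≤ K * Real.exp (k * |z.im|))
    (ha : ∀ z : ℂ, z.re = a → ‖f z‖ ≤ C) (hb : ∀ z : ℂ, z.re = b → ‖f z‖ ≤ C)
    {z : ℂ} (hz : z.re ∈ Icc a b) : ‖f z‖ ≤ C := by
  have hba : 0 < b - a := sub_pos.2 hab
  have hc : 0 < π / (2 * (b - a)) := by positivity
  refine PhragmenLindelof.vertical_strip hf ⟨π / (2 * (b - a)), ?_, k / (π / (2 * (b - a))), ?_⟩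
    ha hb hz.1 hz.2
  · exact div_lt_div_of_pos_left Real.pi_pos hba (by linarith)
  · refine Asymptotics.IsBigO.of_bound |K| ?_
    have h1 : ∀ᶠ z in comap (_root_.abs ∘ im) atTop ⊓ 𝓟 (re ⁻¹' Ioo a b),
        1 ≤ |z.im| ∧ z.re ∈ Ioo a b :=
      ((tendsto_comap.eventually (eventually_ge_atTop 1)).filter_mono inf_le_left).and
        (mem_inf_of_right (mem_principal_self _))
    filter_upwards [h1] with w hw
    refine (hgrowth w hw.2 hw.1).trans ?_
    rw [Real.norm_of_nonneg (Real.exp_pos _).le]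
    refine mul_le_mul (le_abs_self K) (Real.exp_le_exp.2 ?_) (Real.exp_pos _).le (abs_nonneg _)
    -- `k |t| ≤ (k / c) exp (c |t|)` turns exponential growth into the double exponential form
    set c := π / (2 * (b - a))
    calc k * |w.im| = k / c * (c * |w.im|) := by field_simp
      _ ≤ k / c * Real.exp (c * |w.im|) := by
        refine mul_le_mul_of_nonneg_left ?_ (by positivity)
        linarith [Real.add_one_le_exp (c * |w.im|)]

theorem diffContOnCl_verticalStrip {f : ℂ → ℂ} {a b : ℝ}
    (hf : ∀ z : ℂ, z.re ∈ Icc a b → DifferentiableAt ℂ f z) :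
    DiffContOnCl ℂ f (re ⁻¹' Ioo a b) := by
  refine DifferentiableOn.diffContOnCl fun z hz => (hf z ?_).differentiableWithinAt
  have : closure (re ⁻¹' Ioo a b) ⊆ re ⁻¹' Icc a b :=
    closure_minimal (preimage_mono Ioo_subset_Icc_self) (isClosed_Icc.preimage continuous_re)
  exact this hz

/-! ### The size of the factor `χ` -/

theorem norm_cos_le_exp_abs_im (z : ℂ) : ‖cos z‖ ≤ Real.exp |z.im| := by
  rw [cos, norm_div, RCLike.norm_ofNat]
  have h1 : ‖exp (z * I)‖ ≤ Real.exp |z.im| := by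
    rw [norm_exp]; gcongr; simpa using neg_le_abs z.im
  have h2 : ‖exp (-z * I)‖ ≤ Real.exp |z.im| := by
    rw [norm_exp]; gcongr; simpa using le_abs_self z.im
  linarith [norm_add_le (exp (z * I)) (exp (-z * I))]

theorem norm_sin_le_exp_abs_im (z : ℂ) : ‖sin z‖ ≤ Real.exp |z.im| := by
  have := norm_cos_le_exp_abs_im (z - π / 2)
  rw [Complex.cos_sub_pi_div_two] at this
  convert this using 2
  simp [Complex.sub_im]

theorem norm_Gamma_le_Gamma_re {s : ℂ} (hs : 0 < s.re) : ‖Gamma s‖ ≤ Real.Gamma s.re := by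
  rw [Gamma_eq_integral hs, Real.Gamma_eq_integral hs, GammaIntegral]
  refine (norm_integral_le_integral_norm _).trans_eq (setIntegral_congr_fun measurableSet_Ioi ?_)
  intro x hx
  simp [norm_cpow_eq_rpow_re_of_pos (mem_Ioi.1 hx), norm_exp]

theorem exists_norm_Gamma_le {a : ℝ} (b : ℝ) (ha : 0 < a) :
    ∃ M : ℝ, 0 ≤ M ∧ ∀ s : ℂ, s.re ∈ Icc a b → ‖Gamma s‖ ≤ M := by
  have hcont : ContinuousOn Real.Gamma (Icc a b) := fun x hx =>
    (Real.differentiableAt_Gamma fun m => by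
      have : 0 ≤ (m : ℝ) := m.cast_nonneg
      linarith [hx.1]).continuousAt.continuousWithinAt
  obtain ⟨M, hM⟩ := isCompact_Icc.exists_bound_of_continuousOn hcont
  refine ⟨|M|, abs_nonneg _, fun s hs => ?_⟩
  exact (norm_Gamma_le_Gamma_re (ha.trans_le hs.1)).trans
    ((le_abs_self _).trans ((hM _ hs).trans (le_abs_self _)))

theorem zetaChi_one_sub (s : ℂ) :
    zetaChi (1 - s) = 2 * (2 * (π : ℂ)) ^ (-s) * cos ((π : ℂ) * s / 2) * Gamma s := by
  rw [zetaChi, sub_sub_cancel]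

theorem norm_two_pi_cpow (s : ℂ) : ‖(2 * (π : ℂ)) ^ s‖ = (2 * π) ^ s.re := by
  have := norm_cpow_eq_rpow_re_of_pos (x := 2 * π) (by positivity) s
  rwa [ofReal_mul, ofReal_ofNat] at this

/-- `χ` is unimodular on the critical line, by the reflection formula for `Γ`. -/
theorem norm_zetaChi_of_re_eq_half {s : ℂ} (hs : s.re = 1 / 2) : ‖zetaChi (1 - s)‖ = 1 := by
  have hconj : (starRingEnd ℂ) s = 1 - s := by
    apply Complex.ext
    · simp [hs]; norm_num
    · simp
  have hcosc : (starRingEnd ℂ) (cos (π * s / 2)) = cos (π * (1 - s) / 2) := by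
    rw [← Complex.cos_conj, map_div₀, map_mul, hconj, conj_ofReal, map_ofNat]
  have hcos : 2 * (cos (π * s / 2) * cos (π * (1 - s) / 2)) = sin (π * s) := by
    have h1 : (π : ℂ) * (1 - s) / 2 = π / 2 - π * s / 2 := by ring
    rw [h1, Complex.cos_pi_div_two_sub, show (π : ℂ) * s = 2 * (π * s / 2) by ring,
      Complex.sin_two_mul]
    ring_nf
  have hsin : sin (π * s) ≠ 0 := by
    rw [Ne, Complex.sin_eq_zero_iff]
    rintro ⟨k, hk⟩
    have hk' : s = k := by
      have : (π : ℂ) ≠ 0 := by exact_mod_cast Real.pi_ne_zero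
      apply mul_left_cancel₀ this; rw [hk]; ring
    rw [hk', intCast_re] at hs
    have : (2 * k : ℤ) = 1 := by exact_mod_cast (by linarith : (2 * k : ℝ) = 1)
    omega
  have hG : ‖Gamma s‖ ^ 2 * ‖cos (π * s / 2)‖ ^ 2 = π / 2 := by
    have h1 : (‖Gamma s‖ ^ 2 * ‖cos (π * s / 2)‖ ^ 2 : ℂ) = π / 2 := by
      rw [← Complex.mul_conj', ← Complex.mul_conj', ← Gamma_conj, hconj, hcosc,
        Complex.Gamma_mul_Gamma_one_sub, ← hcos]
      rw [← hcos] at hsin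
      have := right_ne_zero_of_mul hsin
      rw [div_mul_eq_mul_div, mul_div_mul_right _ _ this]
    exact_mod_cast h1
  have hsq : ‖zetaChi (1 - s)‖ ^ 2 = 1 := by
    rw [zetaChi_one_sub, norm_mul, norm_mul, norm_mul, norm_two_pi_cpow, neg_re, hs,
      RCLike.norm_ofNat]
    have h2 : ((2 * π) ^ (-(1 / 2) : ℝ)) ^ 2 = (2 * π)⁻¹ := by
      rw [← Real.rpow_natCast, ← Real.rpow_mul (by positivity)]
      norm_num [Real.rpow_neg_one]
    calc (2 * (2 * π) ^ (-(1 / 2) : ℝ) * ‖cos (π * s / 2)‖ * ‖Gamma s‖) ^ 2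
        = 4 * ((2 * π) ^ (-(1 / 2) : ℝ)) ^ 2 * (‖Gamma s‖ ^ 2 * ‖cos (π * s / 2)‖ ^ 2) := by ring
      _ = 1 := by
        rw [h2, hG]; field_simp; norm_num
  exact (sq_eq_sq₀ (norm_nonneg _) zero_le_one).1 (by rw [hsq]; norm_num)

/-- Two steps to the right only multiply `χ` by a quadratic polynomial, which gives its modulus on
`Re s = 5/2` from the critical line. -/
theorem zetaChi_one_sub_add_two {s : ℂ} (h0 : s ≠ 0) (h1 : s ≠ -1) :
    zetaChi (1 - (s + 2)) = -(s * (s + 1) / (2 * (π : ℂ)) ^ 2) * zetaChi (1 - s) := by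
  have h1' : s + 1 ≠ 0 := fun h => h1 (eq_neg_of_add_eq_zero_left h)
  have hpi : (2 * (π : ℂ)) ≠ 0 := by simp
  have hcos : cos ((π : ℂ) * (s + 2) / 2) = -cos ((π : ℂ) * s / 2) := by
    rw [show (π : ℂ) * (s + 2) / 2 = π * s / 2 + π by ring, Complex.cos_add_pi]
  have hG : Gamma (s + 2) = (s + 1) * (s * Gamma s) := by
    rw [show s + 2 = s + 1 + 1 by ring, Gamma_add_one _ h1', Gamma_add_one _ h0]
  have hpow : (2 * (π : ℂ)) ^ (-(s + 2)) = (2 * (π : ℂ)) ^ (-s) / (2 * (π : ℂ)) ^ 2 := by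
    rw [show -(s + 2) = -s - (2 : ℕ) by push_cast; ring, cpow_sub _ _ hpi, cpow_natCast]
  rw [zetaChi_one_sub, zetaChi_one_sub, hcos, hG, hpow]
  ring

theorem norm_zetaChi_le_of_re_eq_five_halves {s : ℂ} (hs : s.re = 5 / 2) :
    ‖zetaChi (1 - s)‖ ≤ ((|s.im| + 3 / 2) / (2 * π)) ^ 2 := by
  obtain ⟨w, rfl⟩ : ∃ w, s = w + 2 := ⟨s - 2, by ring⟩
  have hw : w.re = 1 / 2 := by
    rw [add_re, re_ofNat] at hs; linarith
  have hw' : (w + 2).im = w.im := by simp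
  rw [zetaChi_one_sub_add_two (fun h => by norm_num [h] at hw) (fun h => by norm_num [h] at hw),
    norm_mul, norm_zetaChi_of_re_eq_half hw, mul_one, norm_neg, norm_div, norm_mul, norm_pow, hw',
    div_pow]
  have h1 : ‖w‖ ≤ |w.im| + 3 / 2 := by
    have := norm_le_abs_re_add_abs_im w
    rw [hw] at this; norm_num at this; linarith
  have h2 : ‖w + 1‖ ≤ |w.im| + 3 / 2 := by
    have := norm_le_abs_re_add_abs_im (w + 1)
    rw [add_re, add_im, hw] at this; norm_num at this; linarith
  have h3 : ‖(2 * (π : ℂ))‖ = 2 * π := by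
    rw [norm_mul, RCLike.norm_ofNat, norm_real, Real.norm_of_nonneg Real.pi_pos.le]
  rw [h3, sq (|w.im| + 3 / 2)]
  gcongr

theorem differentiableAt_zetaChi_one_sub {s : ℂ} (hs : 0 < s.re) :
    DifferentiableAt ℂ (fun z => zetaChi (1 - z)) s := by
  have hfun : (fun z => zetaChi (1 - z)) =
      fun z => 2 * (2 * (π : ℂ)) ^ (-z) * cos ((π : ℂ) * z / 2) * Gamma z :=
    funext zetaChi_one_sub
  rw [hfun]
  have hpi : (2 * (π : ℂ)) ≠ 0 := by simp
  have hG : DifferentiableAt ℂ Gamma s := differentiableAt_Gamma s fun m h => by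
    have : (0 : ℝ) ≤ m := m.cast_nonneg
    rw [h, neg_re, natCast_re] at hs
    linarith
  have hp : DifferentiableAt ℂ (fun z : ℂ => (2 * (π : ℂ)) ^ (-z)) s :=
    (differentiableAt_id.neg).const_cpow (Or.inl hpi)
  refine ((hp.const_mul 2).mul ?_).mul hG
  fun_prop

theorem exists_norm_zetaChi_le :
    ∃ K : ℝ, 0 ≤ K ∧ ∀ s : ℂ, s.re ∈ Icc (1 / 2 : ℝ) (5 / 2) →
      ‖zetaChi (1 - s)‖ ≤ K * Real.exp (2 * |s.im|) := by
  obtain ⟨M, hM0, hM⟩ := exists_norm_Gamma_le (a := 1 / 2) (5 / 2) (by norm_num)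
  refine ⟨2 * M, by positivity, fun s hs => ?_⟩
  rw [zetaChi_one_sub, norm_mul, norm_mul, norm_mul, norm_two_pi_cpow, RCLike.norm_ofNat]
  have h1 : (2 * π) ^ (-s).re ≤ 1 :=
    Real.rpow_le_one_of_one_le_of_nonpos (by linarith [Real.pi_gt_three])
      (by rw [neg_re]; linarith [hs.1])
  have h2 : ‖cos (π * s / 2)‖ ≤ Real.exp (2 * |s.im|) := by
    refine (norm_cos_le_exp_abs_im _).trans (Real.exp_le_exp.2 ?_)
    have : ((π : ℂ) * s / 2).im = π / 2 * s.im := by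
      rw [show (π : ℂ) * s / 2 = ((π / 2 : ℝ) : ℂ) * s by push_cast; ring, im_ofReal_mul]
    rw [this, abs_mul, abs_of_pos (by positivity)]
    gcongr
    linarith [Real.pi_lt_four]
  calc 2 * (2 * π) ^ (-s).re * ‖cos (π * s / 2)‖ * ‖Gamma s‖
      ≤ 2 * 1 * Real.exp (2 * |s.im|) * M := by gcongr; exact hM s hs
    _ = 2 * M * Real.exp (2 * |s.im|) := by ring

/-- The modulus of a Gaussian factor `exp ((s - m - i t₀)² / y)`. -/
theorem norm_exp_sq_div (s : ℂ) (m t₀ y : ℝ) :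
    ‖exp ((s - m - t₀ * I) ^ 2 / y)‖ =
      Real.exp (((s.re - m) ^ 2 - (s.im - t₀) ^ 2) / y) := by
  rw [norm_exp, div_ofReal_re]
  congr 2
  simp [sq]

/-- The size of `χ` to the right of the critical line. Three lines between `Re s = 1/2` and
`Re s = 5/2`, with a Gaussian factor that localizes at the height of `s`. -/
theorem norm_zetaChi_le {s : ℂ} (hs : s.re ∈ Icc (1 / 2 : ℝ) (5 / 2)) {y : ℝ}
    (hy : |s.im| + 3 / 2 ≤ y) :
    ‖zetaChi (1 - s)‖ ≤ Real.exp (2 / y) * (y / (2 * π)) ^ (s.re - 1 / 2) := by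
  have hy0 : 0 < y := by linarith [abs_nonneg s.im]
  set t₀ := s.im with ht₀
  set r := y / (2 * π) with hr
  have hr0 : 0 < r := by positivity
  have hrc : (r : ℂ) ≠ 0 := by exact_mod_cast hr0.ne'
  set f : ℂ → ℂ := fun z => zetaChi (1 - z) * (r : ℂ) ^ (1 / 2 - z) *
    exp ((z - (3 / 2 : ℝ) - t₀ * I) ^ 2 / y) with hf
  have hfn : ∀ z, ‖f z‖ = ‖zetaChi (1 - z)‖ * r ^ (1 / 2 - z.re) *
      Real.exp (((z.re - 3 / 2) ^ 2 - (z.im - t₀) ^ 2) / y) := fun z => by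
    rw [hf]
    simp only [norm_mul]
    rw [norm_exp_sq_div, norm_cpow_eq_rpow_re_of_pos hr0]
    norm_num
  obtain ⟨K, hK0, hK⟩ := exists_norm_zetaChi_le
  have key : ‖f s‖ ≤ Real.exp (2 / y) := by
    refine norm_le_of_verticalStrip (a := 1 / 2) (b := 5 / 2) (k := 2)
      (K := K * (max 1 r⁻¹) ^ (2 : ℝ) * Real.exp (1 / y))
      (by norm_num) (by norm_num) ?_ ?_ ?_ ?_ hs
    · refine diffContOnCl_verticalStrip fun z hz => ?_
      refine ((differentiableAt_zetaChi_one_sub (by linarith [hz.1])).mul ?_).mul ?_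
      · exact DifferentiableAt.const_cpow (by fun_prop) (Or.inl hrc)
      · fun_prop
    · intro z hz _
      rw [hfn]
      have h1 : r ^ (1 / 2 - z.re) ≤ (max 1 r⁻¹) ^ (2 : ℝ) := by
        rw [show 1 / 2 - z.re = -(z.re - 1 / 2) by ring, Real.rpow_neg hr0.le,
          ← Real.inv_rpow hr0.le]
        calc r⁻¹ ^ (z.re - 1 / 2) ≤ (max 1 r⁻¹) ^ (z.re - 1 / 2) := by
              gcongr
              · linarith [hz.1]
              · exact le_max_right _ _
          _ ≤ _ := Real.rpow_le_rpow_of_exponent_le (le_max_left _ _) (by linarith [hz.2])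
      have h2 : Real.exp (((z.re - 3 / 2) ^ 2 - (z.im - t₀) ^ 2) / y) ≤ Real.exp (1 / y) := by
        gcongr
        nlinarith [hz.1, hz.2, sq_nonneg (z.im - t₀)]
      calc _ ≤ K * Real.exp (2 * |z.im|) * (max 1 r⁻¹) ^ (2 : ℝ) * Real.exp (1 / y) := by
            gcongr
            exact hK z (Ioo_subset_Icc_self hz)
        _ = _ := by ring
    · intro z hz
      rw [hfn, norm_zetaChi_of_re_eq_half hz, hz, sub_self, Real.rpow_zero, one_mul, one_mul]
      gcongr
      nlinarith [sq_nonneg (z.im - t₀)]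
    · intro z hz
      set u := |z.im - t₀| with hu
      -- the growth `exp (2u/y)` in the distance `u` from the centre is absorbed by `exp (-u²/y)`
      have h1 : |z.im| + 3 / 2 ≤ y * Real.exp (u / y) := by
        have h2 : |z.im| ≤ |t₀| + u := by
          have := abs_add_le t₀ (z.im - t₀)
          rwa [add_sub_cancel] at this
        have h3 := Real.add_one_le_exp (u / y)
        have h4 : y * (u / y + 1) = u + y := by field_simp
        nlinarith
      have h2 := norm_zetaChi_le_of_re_eq_five_halves hz
      have h3 : r ^ (1 / 2 - z.re) = (r ^ 2)⁻¹ := by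
        rw [hz, show (1 / 2 - 5 / 2 : ℝ) = -(2 : ℕ) by norm_num, Real.rpow_neg hr0.le,
          Real.rpow_natCast]
      rw [hfn, h3, hz, ← sq_abs (z.im - t₀), ← hu]
      calc _ ≤ (y * Real.exp (u / y) / (2 * π)) ^ 2 * (r ^ 2)⁻¹ *
              Real.exp (((5 / 2 - 3 / 2) ^ 2 - u ^ 2) / y) := by
            gcongr
            refine h2.trans ?_
            gcongr
        _ = Real.exp (2 * (u / y) + ((5 / 2 - 3 / 2) ^ 2 - u ^ 2) / y) := by
            rw [Real.exp_add, two_mul (u / y), Real.exp_add, hr]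
            field_simp
        _ ≤ Real.exp (2 / y) := by
            gcongr
            rw [← mul_div_assoc, ← add_div]
            gcongr
            nlinarith [sq_nonneg (u - 1)]
  rw [hfn, sub_self] at key
  have h1 : 1 ≤ Real.exp (((s.re - 3 / 2) ^ 2 - 0 ^ 2) / y) := by
    apply Real.one_le_exp
    simp; positivity
  have h2 : r ^ (1 / 2 - s.re) = (r ^ (s.re - 1 / 2))⁻¹ := by
    rw [← Real.rpow_neg hr0.le]; congr 1; ring
  have h3 : ‖zetaChi (1 - s)‖ * r ^ (1 / 2 - s.re) ≤ Real.exp (2 / y) :=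
    (le_mul_of_one_le_right (by positivity) h1).trans key
  rw [h2, ← div_eq_mul_inv, div_le_iff₀ (by positivity)] at h3
  exact h3

/-! ### Boundedness of the completed zeta function in strips -/

/-- A Mellin transform is bounded in every closed vertical strip of convergence. -/
theorem norm_mellin_le {f : ℝ → ℂ} {a b : ℝ} (ha : MellinConvergent f a)
    (hb : MellinConvergent f b) {s : ℂ} (hs : s.re ∈ Icc a b) :
    ‖mellin f s‖ ≤ ∫ t in Ioi (0 : ℝ),
      (‖(t : ℂ) ^ ((a : ℂ) - 1) • f t‖ + ‖(t : ℂ) ^ ((b : ℂ) - 1) • f t‖) := by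
  refine norm_integral_le_of_norm_le (ha.norm.add hb.norm) ?_
  refine (ae_restrict_iff' measurableSet_Ioi).2 (Eventually.of_forall fun t ht => ?_)
  have ht0 : 0 < t := ht
  rw [norm_smul, norm_smul, norm_smul, ← add_mul, norm_cpow_eq_rpow_re_of_pos ht0,
    norm_cpow_eq_rpow_re_of_pos ht0, norm_cpow_eq_rpow_re_of_pos ht0]
  simp only [sub_re, one_re, ofReal_re]
  refine mul_le_mul_of_nonneg_right ?_ (norm_nonneg _)
  have h1 := Real.rpow_nonneg ht0.le (a - 1)
  have h2 := Real.rpow_nonneg ht0.le (b - 1)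
  rcases le_total t 1 with h | h
  · have := Real.rpow_le_rpow_of_exponent_ge ht0 h (show a - 1 ≤ s.re - 1 by linarith [hs.1])
    linarith
  · have := Real.rpow_le_rpow_of_exponent_le h (show s.re - 1 ≤ b - 1 by linarith [hs.2])
    linarith

theorem exists_norm_completedRiemannZeta₀_le (a b : ℝ) :
    ∃ M : ℝ, ∀ s : ℂ, s.re ∈ Icc a b → ‖completedRiemannZeta₀ s‖ ≤ M := by
  have hconv : ∀ s : ℂ, MellinConvergent (HurwitzZeta.hurwitzEvenFEPair 0).f_modif s := fun s =>
    ((HurwitzZeta.hurwitzEvenFEPair 0).isStrongFEPair_toStrongFEPair.hasMellin s).1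
  have hre : ∀ s : ℂ, s.re ∈ Icc a b → (s / 2).re ∈ Icc (a / 2) (b / 2) := fun s hs => by
    rw [show s / 2 = s / (2 : ℝ) by norm_num, div_ofReal_re]
    exact ⟨by linarith [hs.1], by linarith [hs.2]⟩
  have hbound := fun s hs => norm_mellin_le (a := a / 2) (b := b / 2) (hconv _) (hconv _) (hre s hs)
  refine ⟨_, fun s hs => le_trans ?_ (hbound s hs)⟩
  have h1 : ‖completedRiemannZeta₀ s‖ ≤
      ‖mellin (HurwitzZeta.hurwitzEvenFEPair 0).f_modif (s / 2)‖ := by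
    rw [show completedRiemannZeta₀ s =
      mellin (HurwitzZeta.hurwitzEvenFEPair 0).f_modif (s / 2) / 2 from rfl, norm_div,
      RCLike.norm_ofNat]
    linarith [norm_nonneg (mellin (HurwitzZeta.hurwitzEvenFEPair 0).f_modif (s / 2))]
  exact h1

/-! ### The entire function `(s - 1) ζ(s)` -/

/-- The entire function `(s - 1) ζ(s)`, with its removable singularity at `s = 1` filled in. -/
noncomputable def zetaMulSub : ℂ → ℂ :=
  Function.update (fun s => (s - 1) * riemannZeta s) 1 1

theorem zetaMulSub_of_ne {s : ℂ} (hs : s ≠ 1) : zetaMulSub s = (s - 1) * riemannZeta s :=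
  Function.update_of_ne hs _ _

theorem differentiable_zetaMulSub : Differentiable ℂ zetaMulSub := by
  rw [← differentiableOn_univ,
    ← differentiableOn_compl_singleton_and_continuousAt_iff (c := 1) Filter.univ_mem]
  refine ⟨DifferentiableOn.congr (f := fun s ↦ (s - 1) * riemannZeta s)
    (fun s hs ↦ ?_) fun _ hs ↦ zetaMulSub_of_ne (Set.mem_sdiff_singleton.mp hs).2,
    continuousWithinAt_compl_self.mp ?_⟩
  · exact (((differentiableAt_id.sub_const 1).mul
      (differentiableAt_riemannZeta (Set.mem_sdiff_singleton.mp hs).2))).differentiableWithinAt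
  · simpa [zetaMulSub] using riemannZeta_residue_one

theorem exists_norm_Gamma_inv_le :
    ∃ M : ℝ, 0 ≤ M ∧ ∀ s : ℂ, s.re ∈ Icc (-1 : ℝ) (3 / 4) → s.im ≠ 0 →
      ‖(Gamma s)⁻¹‖ ≤ M * Real.exp (4 * |s.im|) := by
  obtain ⟨M, hM0, hM⟩ := exists_norm_Gamma_le (a := 1 / 4) 2 (by norm_num)
  refine ⟨M, hM0, fun s hs him => ?_⟩
  have hG : Gamma s ≠ 0 := Gamma_ne_zero fun m h => him (by rw [h]; simp)
  have hG' : Gamma (1 - s) ≠ 0 := Gamma_ne_zero fun m h => him (by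
    have := congrArg im h
    simpa using this)
  have hpi : (π : ℂ) ≠ 0 := by simp
  have h := Complex.Gamma_mul_Gamma_one_sub s
  have hsin : sin (π * s) ≠ 0 := by
    intro h0
    rw [h0, div_zero] at h
    exact mul_ne_zero hG hG' h
  have h1 : (Gamma s)⁻¹ = Gamma (1 - s) * sin (π * s) / π := by
    rw [eq_div_iff hsin] at h
    rw [eq_div_iff hpi, inv_mul_eq_iff_eq_mul₀ hG, ← mul_assoc, h]
  rw [h1, norm_div, norm_mul, norm_real, Real.norm_of_nonneg Real.pi_pos.le]
  have h2 : ‖Gamma (1 - s)‖ ≤ M :=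
    hM _ (by rw [sub_re, one_re]; exact ⟨by linarith [hs.2], by linarith [hs.1]⟩)
  have h3 : ‖sin (π * s)‖ ≤ Real.exp (4 * |s.im|) := by
    refine (norm_sin_le_exp_abs_im _).trans (Real.exp_le_exp.2 ?_)
    rw [im_ofReal_mul, abs_mul, abs_of_pos Real.pi_pos]
    gcongr
    exact Real.pi_lt_four.le
  rw [div_le_iff₀ Real.pi_pos]
  calc ‖Gamma (1 - s)‖ * ‖sin (π * s)‖ ≤ M * Real.exp (4 * |s.im|) := by gcongr
    _ ≤ M * Real.exp (4 * |s.im|) * π :=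
      le_mul_of_one_le_right (by positivity) (by linarith [Real.pi_gt_three])

/-- The crude growth bound that Phragmén–Lindelöf needs, from `ζ(s) = Λ(s) π ^ (s/2) / Γ(s/2)`. -/
theorem exists_norm_zetaMulSub_le :
    ∃ K : ℝ, 0 ≤ K ∧ ∀ s : ℂ, s.re ∈ Icc (-1 : ℝ) (3 / 2) → 1 ≤ |s.im| →
      ‖zetaMulSub s‖ ≤ K * Real.exp (3 * |s.im|) := by
  obtain ⟨M, hM0, hM⟩ := exists_norm_Gamma_inv_le
  obtain ⟨L, hL⟩ := exists_norm_completedRiemannZeta₀_le (-1) (3 / 2)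
  refine ⟨4 * (|L| + 2) * (4 * M), by positivity, fun s hs him => ?_⟩
  have him0 : s.im ≠ 0 := by
    intro h; rw [h, abs_zero] at him; linarith
  have hs0 : s ≠ 0 := fun h => him0 (by simp [h])
  have hs1 : s ≠ 1 := fun h => him0 (by simp [h])
  have hn1 : 1 ≤ ‖s‖ := him.trans (abs_im_le_norm s)
  have hn2 : 1 ≤ ‖1 - s‖ := by
    have := abs_im_le_norm (1 - s)
    rw [sub_im, one_im, zero_sub, abs_neg] at this
    exact him.trans this
  have hΛ : ‖completedRiemannZeta₀ s - 1 / s - 1 / (1 - s)‖ ≤ |L| + 2 := by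
    have h1 : ‖1 / s‖ ≤ 1 := by
      rw [norm_div, norm_one]; exact div_le_one_of_le₀ hn1 (norm_nonneg _)
    have h2 : ‖1 / (1 - s)‖ ≤ 1 := by
      rw [norm_div, norm_one]; exact div_le_one_of_le₀ hn2 (norm_nonneg _)
    have h3 := norm_sub_le (completedRiemannZeta₀ s - 1 / s) (1 / (1 - s))
    have h4 := norm_sub_le (completedRiemannZeta₀ s) (1 / s)
    have h5 := (hL s hs).trans (le_abs_self L)
    linarith
  have hre : (s / 2).re = s.re / 2 := by
    rw [show s / 2 = s / (2 : ℝ) by norm_num, div_ofReal_re]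
  have himh : (s / 2).im = s.im / 2 := by
    rw [show s / 2 = s / (2 : ℝ) by norm_num, div_ofReal_im]
  have hG : ‖(Gamma (s / 2))⁻¹‖ ≤ M * Real.exp (2 * |s.im|) := by
    have := hM (s / 2) (by rw [hre]; exact ⟨by linarith [hs.1], by linarith [hs.2]⟩)
      (by rw [himh]; simpa using him0)
    rwa [himh, abs_div, abs_two, show 4 * (|s.im| / 2) = 2 * |s.im| by ring] at this
  have hp : ‖((π : ℂ) ^ (-s / 2))⁻¹‖ ≤ 4 := by
    rw [← cpow_neg, norm_cpow_eq_rpow_re_of_pos Real.pi_pos, neg_re, neg_div, neg_re, neg_neg, hre]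
    calc π ^ (s.re / 2) ≤ π ^ (1 : ℝ) :=
          Real.rpow_le_rpow_of_exponent_le (by linarith [Real.pi_gt_three]) (by linarith [hs.2])
      _ ≤ 4 := by rw [Real.rpow_one]; exact Real.pi_lt_four.le
  have hsub : ‖s - 1‖ ≤ 4 * Real.exp |s.im| := by
    have h1 := norm_le_abs_re_add_abs_im (s - 1)
    rw [sub_re, sub_im, one_re, one_im, sub_zero] at h1
    have h2 : |s.re - 1| ≤ 2 := abs_le.2 ⟨by linarith [hs.1], by linarith [hs.2]⟩
    linarith [Real.add_one_le_exp |s.im|]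
  rw [zetaMulSub_of_ne hs1, riemannZeta_eq_completedRiemannZeta₀ hs0, div_eq_mul_inv, mul_inv,
    norm_mul, norm_mul, norm_mul]
  calc _ ≤ 4 * Real.exp |s.im| * ((|L| + 2) * (4 * (M * Real.exp (2 * |s.im|)))) := by gcongr
    _ = 4 * (|L| + 2) * (4 * M) * Real.exp (3 * |s.im|) := by
      rw [show 3 * |s.im| = |s.im| + 2 * |s.im| by ring, Real.exp_add]; ring

/-! ### Bounds to the right of `Re s = 1` -/

theorem summable_one_div_nat_add_one_rpow {x : ℝ} (hx : 1 < x) :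
    Summable fun n : ℕ => 1 / ((n : ℝ) + 1) ^ x := by
  have := (summable_nat_add_iff 1).2 (Real.summable_one_div_nat_rpow.2 hx)
  simpa using this

theorem tsum_one_div_nat_add_one_rpow_le {x : ℝ} (hx : 1 < x) :
    ∑' n : ℕ, 1 / ((n : ℝ) + 1) ^ x ≤ 1 + 1 / (x - 1) := by
  have h1 := ZetaAsymptotics.zeta_limit_aux1 hx
  have h2 : 0 ≤ ZetaAsymptotics.termTSum x :=
    tsum_nonneg fun n => ZetaAsymptotics.term_nonneg (n + 1) x
  have h3 : 0 ≤ x * ZetaAsymptotics.termTSum x := by positivity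
  linarith

theorem norm_riemannZeta_le {s : ℂ} (hs : 1 < s.re) : ‖riemannZeta s‖ ≤ 1 + 1 / (s.re - 1) := by
  rw [zeta_eq_tsum_one_div_nat_add_one_cpow hs]
  have hnorm : ∀ n : ℕ, ‖1 / ((n : ℂ) + 1) ^ s‖ = 1 / ((n : ℝ) + 1) ^ s.re := fun n => by
    have := norm_cpow_eq_rpow_re_of_pos (x := (n : ℝ) + 1) (by positivity) s
    rw [norm_div, norm_one, ← this]
    push_cast
    rfl
  have hsum := summable_one_div_nat_add_one_rpow hs
  refine (norm_tsum_le_tsum_norm (by simpa only [hnorm] using hsum)).trans ?_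
  simp only [hnorm]
  exact tsum_one_div_nat_add_one_rpow_le hs

theorem sum_Icc_rpow_neg_le {x : ℝ} (hx : 1 < x) (N : ℕ) :
    ∑ n ∈ Finset.Icc 1 N, (n : ℝ) ^ (-x) ≤ 1 + 1 / (x - 1) := by
  have h1 : ∑ n ∈ Finset.Icc 1 N, (n : ℝ) ^ (-x) =
      ∑ n ∈ Finset.range N, 1 / ((n : ℝ) + 1) ^ x := by
    rw [← Finset.Ico_add_one_right_eq_Icc, Finset.sum_Ico_eq_sum_range]
    refine Finset.sum_congr (by simp) fun n _ => ?_
    rw [Real.rpow_neg (by positivity), one_div]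
    push_cast
    rw [add_comm]
  rw [h1]
  exact ((summable_one_div_nat_add_one_rpow hx).sum_le_tsum _ fun n _ => by positivity).trans
    (tsum_one_div_nat_add_one_rpow_le hx)

/-! ### The product `ζ(1 - s) ζ(s - 2δ)` -/

theorem riemannZeta_one_sub_eq {s : ℂ} (h0 : ∀ n : ℕ, s ≠ -n) (h1 : s ≠ 1) :
    riemannZeta (1 - s) = zetaChi (1 - s) * riemannZeta s := by
  rw [riemannZeta_one_sub h0 h1, zetaChi_one_sub]
  ring

/-- The bound on the edge `Re w = 1 + 2δ + η` where both Dirichlet series converge, after the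
functional equation; `y + u` majorizes the height. -/
theorem norm_zetaMulSub_mul_le {δ η y u : ℝ} (hδ : δ ∈ Icc (0 : ℝ) (1 / 4))
    (hη : η ∈ Ioc (0 : ℝ) (33 / 100)) {w : ℂ} (hw : w.re = 1 + 2 * δ + η) (hu : 0 ≤ u)
    (hy : 0 < y) (him : |w.im| + 2 ≤ y + u) :
    ‖zetaMulSub (1 - w) * zetaMulSub (w - 2 * δ)‖ ≤
      (1 + 1 / η) * (1 + 1 / (2 * δ + η)) * Real.exp (2 / y) * y ^ 2 *
        (y / (2 * π)) ^ (1 / 2 + 2 * δ + η) * Real.exp ((5 / 2 + 2 * δ + η) * (u / y)) := by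
  obtain ⟨hδ0, hδ1⟩ := hδ
  obtain ⟨hη0, hη1⟩ := hη
  have hw0 : ∀ n : ℕ, w ≠ -n := fun n h => by
    have : (0 : ℝ) ≤ n := n.cast_nonneg
    rw [h, neg_re, natCast_re] at hw
    linarith
  have hw1 : w ≠ 1 := fun h => by
    rw [h, one_re] at hw; linarith
  have h1w : 1 - w ≠ 1 := fun h => by
    have := congrArg re h
    rw [sub_re, one_re, hw] at this; linarith
  have hre2 : (w - 2 * δ).re = 1 + η := by
    simp [hw]; ring
  have hw2 : w - 2 * δ ≠ 1 := fun h => by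
    rw [h, one_re] at hre2; linarith
  rw [zetaMulSub_of_ne h1w, zetaMulSub_of_ne hw2, riemannZeta_one_sub_eq hw0 hw1]
  set E := Real.exp (u / y) with hE
  have hyE : y + u ≤ y * E := by
    have h3 := Real.add_one_le_exp (u / y)
    have h4 : y * (u / y + 1) = u + y := by field_simp
    nlinarith
  have hn1 : ‖1 - w - 1‖ ≤ y * E := by
    rw [show 1 - w - 1 = -w by ring, norm_neg]
    have h := norm_le_abs_re_add_abs_im w
    rw [hw, abs_of_pos (by linarith)] at h
    linarith
  have hn2 : ‖w - 2 * δ - 1‖ ≤ y * E := by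
    have h := norm_le_abs_re_add_abs_im (w - 2 * δ - 1)
    rw [sub_re, hre2, one_re, abs_of_pos (by linarith)] at h
    have him : (w - 2 * δ - 1).im = w.im := by simp
    rw [him] at h
    linarith
  have hz1 : ‖riemannZeta w‖ ≤ 1 + 1 / (2 * δ + η) := by
    have := norm_riemannZeta_le (s := w) (by rw [hw]; linarith)
    rwa [hw, show 1 + 2 * δ + η - 1 = 2 * δ + η by ring] at this
  have hz2 : ‖riemannZeta (w - 2 * δ)‖ ≤ 1 + 1 / η := by
    have := norm_riemannZeta_le (s := w - 2 * δ) (by rw [hre2]; linarith)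
    rwa [hre2, show 1 + η - 1 = η by ring] at this
  have hχ : ‖zetaChi (1 - w)‖ ≤
      Real.exp (2 / y) * (y * E / (2 * π)) ^ (1 / 2 + 2 * δ + η) := by
    have h := norm_zetaChi_le (s := w) (y := y * E)
      (by rw [hw]; exact ⟨by linarith, by linarith⟩) (by linarith)
    rw [hw, show 1 + 2 * δ + η - 1 / 2 = 1 / 2 + 2 * δ + η by ring] at h
    refine h.trans ?_
    gcongr
    linarith
  have hpow : (y * E / (2 * π)) ^ (1 / 2 + 2 * δ + η) =
      (y / (2 * π)) ^ (1 / 2 + 2 * δ + η) * Real.exp ((1 / 2 + 2 * δ + η) * (u / y)) := by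
    rw [mul_div_right_comm, Real.mul_rpow (by positivity) (Real.exp_pos _).le, ← Real.exp_mul,
      mul_comm (u / y)]
  have hE2 : Real.exp ((5 / 2 + 2 * δ + η) * (u / y)) =
      E * E * Real.exp ((1 / 2 + 2 * δ + η) * (u / y)) := by
    rw [hE, ← Real.exp_add, ← Real.exp_add]; congr 1; ring
  rw [norm_mul, norm_mul, norm_mul, norm_mul, hE2]
  rw [hpow] at hχ
  calc _ ≤ y * E * (Real.exp (2 / y) * ((y / (2 * π)) ^ (1 / 2 + 2 * δ + η) *
        Real.exp ((1 / 2 + 2 * δ + η) * (u / y))) * (1 + 1 / (2 * δ + η))) *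
        (y * E * (1 + 1 / η)) := by gcongr
    _ = _ := by ring

/-- The numerical loss in the maximum principle: the edges lie at distance at most `1.08` from the
centre of the strip, and `u` is the distance from the height `T` of the centre of the Gaussian. -/
theorem edge_constant_le {T p d u B : ℝ} (hT : 100 ≤ T) (hp0 : 0 ≤ p) (hp : p ≤ 133 / 100)
    (hd : |d| ≤ 108 / 100) (hu : 0 ≤ u) (hB : 0 ≤ B) :
    B * Real.exp (2 / (T + 2)) * (T + 2) ^ 2 * ((T + 2) / (2 * π)) ^ p *
        Real.exp ((2 + p) * (u / (T + 2))) * Real.exp ((d ^ 2 - u ^ 2) / T) ≤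
      T ^ 2 * (1.14 * (B * (T / (2 * π)) ^ p)) := by
  have hT0 : 0 < T := by linarith
  have h1 : T + 2 ≤ T * Real.exp (2 / T) := by
    have h3 := Real.add_one_le_exp (2 / T)
    have h4 : T * (2 / T + 1) = 2 + T := by field_simp
    nlinarith
  have h2 : ((T + 2) / (2 * π)) ^ p ≤ (T / (2 * π)) ^ p * Real.exp (p * (2 / T)) := by
    calc ((T + 2) / (2 * π)) ^ p ≤ (T / (2 * π) * Real.exp (2 / T)) ^ p := by
          gcongr
          rw [div_mul_eq_mul_div]
          gcongr
      _ = _ := by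
          rw [Real.mul_rpow (by positivity) (Real.exp_pos _).le, ← Real.exp_mul,
            mul_comm (2 / T) p]
  have h3 : (T + 2) ^ 2 ≤ T ^ 2 * Real.exp (2 * (2 / T)) := by
    calc (T + 2) ^ 2 ≤ (T * Real.exp (2 / T)) ^ 2 := by gcongr
      _ = _ := by rw [mul_pow, ← Real.exp_nat_mul]; norm_num
  have h4 : Real.exp (2 / (T + 2)) ≤ Real.exp (2 / T) := by gcongr; linarith
  have h5 : Real.exp ((2 + p) * (u / (T + 2))) ≤ Real.exp ((2 + p) * (u / T)) := by
    gcongr; linarith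
  have h6 : Real.exp (2 / T) * Real.exp (2 * (2 / T)) * Real.exp (p * (2 / T)) *
      Real.exp ((2 + p) * (u / T)) * Real.exp ((d ^ 2 - u ^ 2) / T) ≤ 1.14 := by
    rw [← Real.exp_add, ← Real.exp_add, ← Real.exp_add, ← Real.exp_add]
    have h7 : 2 / T + 2 * (2 / T) + p * (2 / T) + (2 + p) * (u / T) + (d ^ 2 - u ^ 2) / T ≤
        13 / 100 := by
      have h8 : 2 / T + 2 * (2 / T) + p * (2 / T) + (2 + p) * (u / T) + (d ^ 2 - u ^ 2) / T =
        (6 + 2 * p + (2 + p) * u + d ^ 2 - u ^ 2) / T := by field_simp; ring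
      rw [h8, div_le_iff₀ hT0]
      have h9 : d ^ 2 ≤ (108 / 100) ^ 2 := by
        rw [← sq_abs d]; gcongr
      nlinarith [sq_nonneg (u - (2 + p) / 2)]
    refine (Real.exp_le_exp.2 h7).trans ?_
    have := Real.exp_bound' (x := 13 / 100) (by norm_num) (by norm_num) (n := 3) (by norm_num)
    refine this.trans ?_
    norm_num [Finset.sum_range_succ, Nat.factorial]
  calc _ ≤ B * Real.exp (2 / T) * (T ^ 2 * Real.exp (2 * (2 / T))) *
        ((T / (2 * π)) ^ p * Real.exp (p * (2 / T))) *
        Real.exp ((2 + p) * (u / T)) * Real.exp ((d ^ 2 - u ^ 2) / T) := by gcongr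
    _ = T ^ 2 * (B * (T / (2 * π)) ^ p) * (Real.exp (2 / T) * Real.exp (2 * (2 / T)) *
        Real.exp (p * (2 / T)) * Real.exp ((2 + p) * (u / T)) *
        Real.exp ((d ^ 2 - u ^ 2) / T)) := by ring
    _ ≤ T ^ 2 * (B * (T / (2 * π)) ^ p) * 1.14 := by gcongr
    _ = _ := by ring

/-- The product `ζ(1 - s) ζ(s - 2δ)` is invariant under `s ↦ 1 + 2δ - s`, so the two edges of the
strip `-η ≤ Re s ≤ 1 + 2δ + η` carry the same bound, and this bound persists inside. -/
theorem norm_riemannZeta_mul_le {δ η T : ℝ} (hδ : δ ∈ Icc (0 : ℝ) (1 / 4))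
    (hη : η ∈ Ioc (0 : ℝ) (33 / 100)) (hT : 100 ≤ T) {s : ℂ}
    (hs : s.re ∈ Icc (-η) (1 + 2 * δ + η)) (him : |s.im| = T) :
    ‖riemannZeta (1 - s) * riemannZeta (s - 2 * δ)‖ ≤
      1.14 * ((1 + 1 / η) * (1 + 1 / (2 * δ + η)) * (T / (2 * π)) ^ (1 / 2 + 2 * δ + η)) := by
  have hδ0 := hδ.1
  have hδ1 := hδ.2
  have hη0 := hη.1
  have hη1 := hη.2
  have hT0 : 0 < T := by linarith
  set t₀ := s.im with ht₀
  set m : ℝ := 1 / 2 + δ with hm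
  set f : ℂ → ℂ := fun z => zetaMulSub (1 - z) * zetaMulSub (z - 2 * δ) *
    exp ((z - m - t₀ * I) ^ 2 / T) with hf
  have hfn : ∀ z, ‖f z‖ = ‖zetaMulSub (1 - z) * zetaMulSub (z - 2 * δ)‖ *
      Real.exp (((z.re - m) ^ 2 - (z.im - t₀) ^ 2) / T) := fun z => by
    rw [hf, norm_mul, norm_exp_sq_div]
  have hheight : ∀ z : ℂ, |z.im| + 2 ≤ T + 2 + |z.im - t₀| := fun z => by
    have := abs_add_le t₀ (z.im - t₀)
    rw [add_sub_cancel, him] at this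
    linarith
  set C := (1 + 1 / η) * (1 + 1 / (2 * δ + η)) * (T / (2 * π)) ^ (1 / 2 + 2 * δ + η) with hC
  have hB : 0 ≤ (1 + 1 / η) * (1 + 1 / (2 * δ + η)) := by positivity
  have hd : |1 / 2 + δ + η| ≤ 108 / 100 := by
    rw [abs_of_pos (by linarith)]; linarith
  have hedge : ∀ w : ℂ, w.re = 1 + 2 * δ + η → ∀ u : ℝ, 0 ≤ u → |w.im| + 2 ≤ T + 2 + u →
      ‖zetaMulSub (1 - w) * zetaMulSub (w - 2 * δ)‖ *
        Real.exp (((1 / 2 + δ + η) ^ 2 - u ^ 2) / T) ≤ T ^ 2 * (1.14 * C) := by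
    intro w hw u hu hwu
    refine (mul_le_mul_of_nonneg_right (norm_zetaMulSub_mul_le hδ hη hw hu (by linarith) hwu)
      (Real.exp_pos _).le).trans ?_
    have := edge_constant_le (p := 1 / 2 + 2 * δ + η) hT (by linarith) (by linarith) hd hu hB
    rwa [show 2 + (1 / 2 + 2 * δ + η) = 5 / 2 + 2 * δ + η by ring] at this
  obtain ⟨K, hK0, hK⟩ := exists_norm_zetaMulSub_le
  have key : ‖f s‖ ≤ T ^ 2 * (1.14 * C) := by
    refine norm_le_of_verticalStrip (a := -η) (b := 1 + 2 * δ + η) (k := 6)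
      (K := K * K * Real.exp ((108 / 100) ^ 2 / T)) (by linarith) (by norm_num) ?_ ?_ ?_ ?_ hs
    · refine diffContOnCl_verticalStrip fun z _ => ?_
      refine ((differentiable_zetaMulSub _).comp z (by fun_prop)).mul
        ((differentiable_zetaMulSub _).comp z (by fun_prop)) |>.mul (by fun_prop)
    · intro z hz hzi
      have him1 : (1 - z).im = -z.im := by simp
      have him2 : (z - 2 * δ).im = z.im := by simp
      have hre2 : (z - 2 * δ).re = z.re - 2 * δ := by simp
      have h1 := hK (1 - z)
        (by rw [sub_re, one_re]; exact ⟨by linarith [hz.2], by linarith [hz.1]⟩)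
        (by rwa [him1, abs_neg])
      have h2 := hK (z - 2 * δ)
        (by rw [hre2]; exact ⟨by linarith [hz.1], by linarith [hz.2]⟩)
        (by rwa [him2])
      rw [him1, abs_neg] at h1
      rw [him2] at h2
      rw [hfn, norm_mul]
      have h3 : Real.exp (((z.re - m) ^ 2 - (z.im - t₀) ^ 2) / T) ≤
          Real.exp ((108 / 100) ^ 2 / T) := by
        gcongr
        have : |z.re - m| ≤ 108 / 100 :=
          abs_le.2 ⟨by linarith [hz.1], by linarith [hz.2]⟩
        have h4 : (z.re - m) ^ 2 ≤ (108 / 100) ^ 2 := by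
          rw [← sq_abs (z.re - m)]; gcongr
        nlinarith [sq_nonneg (z.im - t₀)]
      calc _ ≤ K * Real.exp (3 * |z.im|) * (K * Real.exp (3 * |z.im|)) *
            Real.exp ((108 / 100) ^ 2 / T) := by gcongr
        _ = _ := by
          rw [show 6 * |z.im| = 3 * |z.im| + 3 * |z.im| by ring, Real.exp_add]; ring
    -- the left edge is the image of the right one under `z ↦ 1 + 2δ - z`
    · intro z hz
      have h := hedge (1 + 2 * δ - z) (by simp [hz]) _ (abs_nonneg (z.im - t₀))
        (by have : (1 + 2 * δ - z).im = -z.im := by simp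
            rw [this, abs_neg]; exact hheight z)
      rw [hfn, hz]
      rw [show 1 - (1 + 2 * δ - z) = z - 2 * δ by ring,
        show 1 + 2 * δ - z - 2 * δ = 1 - z by ring, mul_comm (zetaMulSub _), sq_abs] at h
      rwa [show -η - m = -(1 / 2 + δ + η) by rw [hm]; ring, neg_sq]
    · intro z hz
      have h := hedge z hz _ (abs_nonneg (z.im - t₀)) (hheight z)
      rw [sq_abs] at h
      rw [hfn, hz]
      rwa [show 1 + 2 * δ + η - m = 1 / 2 + δ + η by rw [hm]; ring]
  have hne : s.im ≠ 0 := fun h => by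
    rw [← ht₀.symm, h, abs_zero] at him; linarith
  -- at the height of `s` the Gaussian is at least `1`, and the two linear factors are at least `T`
  have h1 : 1 - s ≠ 1 := fun h => hne (by simpa using congrArg im h)
  have h2 : s - 2 * δ ≠ 1 := fun h => hne (by simpa using congrArg im h)
  rw [hfn, sub_self, zetaMulSub_of_ne h1, zetaMulSub_of_ne h2] at key
  have h3 : 1 ≤ Real.exp (((s.re - m) ^ 2 - 0 ^ 2) / T) := by
    apply Real.one_le_exp
    simp; positivity
  have h4 : T ≤ ‖1 - s - 1‖ := by
    have := abs_im_le_norm (1 - s - 1)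
    simpa [← ht₀, him] using this
  have h5 : T ≤ ‖s - 2 * δ - 1‖ := by
    have := abs_im_le_norm (s - 2 * δ - 1)
    simpa [← ht₀, him] using this
  have h6 : T ^ 2 * ‖riemannZeta (1 - s) * riemannZeta (s - 2 * δ)‖ ≤ T ^ 2 * (1.14 * C) := by
    refine le_trans ?_ ((le_mul_of_one_le_right (norm_nonneg _) h3).trans key)
    rw [norm_mul, norm_mul, norm_mul, norm_mul]
    calc _ = T * ‖riemannZeta (1 - s)‖ * (T * ‖riemannZeta (s - 2 * δ)‖) := by ring
      _ ≤ _ := by gcongr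
  exact le_of_mul_le_mul_left h6 (by positivity)

/-! ### The Dirichlet polynomial -/

theorem divisorPowSum_nonneg (a : ℝ) (n : ℕ) : 0 ≤ divisorPowSum a n :=
  Finset.sum_nonneg fun d _ => Real.rpow_nonneg d.cast_nonneg a

/-- A partial sum of `∑ d_a(n) n ^ (-x) = ζ(x - a) ζ(x)` is at most the product of the partial sums
of the two factors. -/
theorem sum_divisorPowSum_mul_rpow_neg_le (a x : ℝ) (N : ℕ) :
    ∑ n ∈ Finset.Icc 1 N, divisorPowSum a n * (n : ℝ) ^ (-x) ≤
      (∑ n ∈ Finset.Icc 1 N, (n : ℝ) ^ (-(x - a))) * ∑ n ∈ Finset.Icc 1 N, (n : ℝ) ^ (-x) := by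
  set P := Finset.Icc 1 N ×ˢ Finset.Icc 1 N with hP
  set g : ℕ × ℕ → ℝ := fun p => (p.1 : ℝ) ^ (-(x - a)) * (p.2 : ℝ) ^ (-x) with hg
  have hg0 : ∀ p, 0 ≤ g p := fun p => by positivity
  have h1 : ∀ n ∈ Finset.Icc 1 N, divisorPowSum a n * (n : ℝ) ^ (-x) ≤
      ∑ p ∈ P with p.1 * p.2 = n, g p := by
    intro n hn
    have hn1 := Finset.mem_Icc.1 hn
    have h2 : divisorPowSum a n * (n : ℝ) ^ (-x) = ∑ p ∈ n.divisorsAntidiagonal, g p := by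
      rw [divisorPowSum, ← Nat.sum_divisorsAntidiagonal (fun d _ => (d : ℝ) ^ a), Finset.sum_mul]
      refine Finset.sum_congr rfl fun p hp => ?_
      obtain ⟨hpn, hn0⟩ := Nat.mem_divisorsAntidiagonal.1 hp
      have hp1 : 0 < p.1 := Nat.pos_of_ne_zero fun h => hn0 (by rw [← hpn, h, zero_mul])
      have hp1' : (0 : ℝ) < p.1 := by exact_mod_cast hp1
      rw [hg, ← hpn]
      push_cast
      rw [Real.mul_rpow p.1.cast_nonneg p.2.cast_nonneg, ← mul_assoc, ← Real.rpow_add hp1']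
      ring_nf
    rw [h2]
    refine Finset.sum_le_sum_of_subset_of_nonneg (fun p hp => ?_) fun p _ _ => hg0 p
    obtain ⟨hpn, hn0⟩ := Nat.mem_divisorsAntidiagonal.1 hp
    have hp1 : 0 < p.1 := Nat.pos_of_ne_zero fun h => hn0 (by rw [← hpn, h, zero_mul])
    have hp2 : 0 < p.2 := Nat.pos_of_ne_zero fun h => hn0 (by rw [← hpn, h, mul_zero])
    have hle1 : p.1 ≤ n := hpn ▸ Nat.le_mul_of_pos_right _ hp2
    have hle2 : p.2 ≤ n := hpn ▸ Nat.le_mul_of_pos_left _ hp1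
    simp only [hP, Finset.mem_filter, Finset.mem_product, Finset.mem_Icc]
    omega
  calc _ ≤ ∑ n ∈ Finset.Icc 1 N, ∑ p ∈ P with p.1 * p.2 = n, g p := Finset.sum_le_sum h1
    _ ≤ ∑ p ∈ P, g p :=
      Finset.sum_fiberwise_le_sum_of_sum_fiber_nonneg fun n _ =>
        Finset.sum_nonneg fun p _ => hg0 p
    _ = _ := by rw [hP, Finset.sum_product, Finset.sum_mul_sum]

/-- Rankin's trick: `(X / n) ^ σ` is nondecreasing in `σ` for `n ≤ X`. -/
theorem norm_dirichletPoly_le {a X x : ℝ} (hX : 0 < X) {s : ℂ} (hs : s.re ≤ x) (hx : 1 < x)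
    (hxa : 1 < x - a) :
    X ^ s.re * ‖∑ n ∈ Finset.Icc 1 ⌊X⌋₊, (divisorPowSum a n : ℂ) / (n : ℂ) ^ s‖ ≤
      X ^ x * ((1 + 1 / (x - a - 1)) * (1 + 1 / (x - 1))) := by
  have hterm : ∀ n ∈ Finset.Icc 1 ⌊X⌋₊, X ^ s.re * ‖(divisorPowSum a n : ℂ) / (n : ℂ) ^ s‖ ≤
      X ^ x * (divisorPowSum a n * (n : ℝ) ^ (-x)) := by
    intro n hn
    obtain ⟨hn1, hn2⟩ := Finset.mem_Icc.1 hn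
    have hn0 : (0 : ℝ) < n := by exact_mod_cast hn1
    have hnX : (n : ℝ) ≤ X := (Nat.le_floor_iff hX.le).1 hn2
    rw [norm_div, norm_natCast_cpow_of_pos hn1, norm_real,
      Real.norm_of_nonneg (divisorPowSum_nonneg a n)]
    have h1 : (X / n) ^ s.re ≤ (X / n) ^ x :=
      Real.rpow_le_rpow_of_exponent_le ((one_le_div hn0).2 hnX) hs
    rw [Real.div_rpow hX.le hn0.le, Real.div_rpow hX.le hn0.le] at h1
    calc _ = divisorPowSum a n * (X ^ s.re / (n : ℝ) ^ s.re) := by ring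
      _ ≤ divisorPowSum a n * (X ^ x / (n : ℝ) ^ x) :=
        mul_le_mul_of_nonneg_left h1 (divisorPowSum_nonneg a n)
      _ = _ := by rw [Real.rpow_neg hn0.le]; ring
  calc _ ≤ X ^ s.re * ∑ n ∈ Finset.Icc 1 ⌊X⌋₊, ‖(divisorPowSum a n : ℂ) / (n : ℂ) ^ s‖ := by
        gcongr; exact norm_sum_le _ _
    _ ≤ X ^ x * ∑ n ∈ Finset.Icc 1 ⌊X⌋₊, divisorPowSum a n * (n : ℝ) ^ (-x) := by
        rw [Finset.mul_sum, Finset.mul_sum]; exact Finset.sum_le_sum hterm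
    _ ≤ _ := by
        gcongr
        refine (sum_divisorPowSum_mul_rpow_neg_le a x _).trans ?_
        exact mul_le_mul (sum_Icc_rpow_neg_le hxa _) (sum_Icc_rpow_neg_le hx _)
          (Finset.sum_nonneg fun n _ => by positivity)
          (add_nonneg zero_le_one (one_div_nonneg.2 (by linarith)))

theorem norm_zetaChi_le_of_large {s : ℂ} {T : ℝ} (hT : 100 ≤ T)
    (hs : s.re ∈ Icc (1 / 2 : ℝ) (183 / 100)) (him : |s.im| = T) :
    ‖zetaChi (1 - s)‖ ≤ 1.05 * (T / (2 * π)) ^ (s.re - 1 / 2) := by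
  have hT0 : 0 < T := by linarith
  have hp0 : 0 ≤ s.re - 1 / 2 := by linarith [hs.1]
  have h1 := norm_zetaChi_le (s := s) (y := T + 3 / 2) ⟨hs.1, by linarith [hs.2]⟩ (by rw [him])
  have h2 : T + 3 / 2 ≤ T * Real.exp ((3 / 2) / T) := by
    have h3 := Real.add_one_le_exp ((3 / 2) / T)
    have h4 : T * ((3 / 2) / T + 1) = 3 / 2 + T := by field_simp
    nlinarith
  have h3 : ((T + 3 / 2) / (2 * π)) ^ (s.re - 1 / 2) ≤
      (T / (2 * π)) ^ (s.re - 1 / 2) * Real.exp ((s.re - 1 / 2) * ((3 / 2) / T)) := by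
    calc _ ≤ (T / (2 * π) * Real.exp ((3 / 2) / T)) ^ (s.re - 1 / 2) := by
          gcongr
          rw [div_mul_eq_mul_div]
          gcongr
      _ = _ := by
          rw [Real.mul_rpow (by positivity) (Real.exp_pos _).le, ← Real.exp_mul,
            mul_comm ((3 / 2) / T)]
  have h4 : Real.exp (2 / (T + 3 / 2)) ≤ Real.exp (2 / T) := by gcongr; linarith
  have h5 : Real.exp (2 / T) * Real.exp ((s.re - 1 / 2) * ((3 / 2) / T)) ≤ 1.05 := by
    rw [← Real.exp_add]
    have h7 : 2 / T + (s.re - 1 / 2) * ((3 / 2) / T) ≤ 4 / 100 := by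
      have h8 : 2 / T + (s.re - 1 / 2) * ((3 / 2) / T) =
        (2 + (s.re - 1 / 2) * (3 / 2)) / T := by field_simp
      rw [h8, div_le_iff₀ hT0]
      linarith [hs.2]
    refine (Real.exp_le_exp.2 h7).trans ?_
    have := Real.exp_bound' (x := 4 / 100) (by norm_num) (by norm_num) (n := 3) (by norm_num)
    refine this.trans ?_
    norm_num [Finset.sum_range_succ, Nat.factorial]
  calc _ ≤ Real.exp (2 / T) * ((T / (2 * π)) ^ (s.re - 1 / 2) *
        Real.exp ((s.re - 1 / 2) * ((3 / 2) / T))) := h1.trans (by gcongr)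
    _ = (Real.exp (2 / T) * Real.exp ((s.re - 1 / 2) * ((3 / 2) / T))) *
        (T / (2 * π)) ^ (s.re - 1 / 2) := by ring
    _ ≤ _ := by gcongr

/-! ### The integrals -/

/-- The two parts of the integrand have the same majorant, up to the constants `1.14` and `1.05`. -/
theorem norm_integrandJ_le {τ δ η T X : ℝ} (hδτ : δ = 1 / 2 - τ) (hδ : δ ∈ Icc (0 : ℝ) (1 / 4))
    (hη : η ∈ Ioc (0 : ℝ) (33 / 100)) (hT : 100 ≤ T) (hX : X = T / (2 * π)) {s : ℂ}
    (hs : s.re ∈ Icc (1 - τ) (2 - 2 * τ + η)) (him : |s.im| = T) :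
    ‖integrandJ τ X s‖ ≤
      2.19 * ((1 + 1 / η) * (1 + 1 / (2 * δ + η)) * X ^ (1 / 2 + 2 * δ + η)) := by
  obtain ⟨hδ0, hδ1⟩ := hδ
  obtain ⟨hη0, hη1⟩ := hη
  obtain ⟨hs1, hs2⟩ := hs
  have hX0 : 0 < X := by rw [hX]; have := Real.pi_pos; positivity
  have hτ : τ = 1 / 2 - δ := by linarith
  subst hτ
  have hne : s.im ≠ 0 := fun h => by
    rw [h, abs_zero] at him; linarith
  have h0 : ∀ n : ℕ, s ≠ -n := fun n h => hne (by rw [h]; simp)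
  have h1 : s ≠ 1 := fun h => hne (by rw [h]; simp)
  set D := ∑ n ∈ Finset.Icc 1 ⌊X⌋₊, (divisorPowSum (1 - 2 * (1 / 2 - δ)) n : ℂ) / (n : ℂ) ^ s
    with hD
  have hsplit : integrandJ (1 / 2 - δ) X s =
      riemannZeta (1 - s) * riemannZeta (s - 2 * δ) - zetaChi (1 - s) * D := by
    rw [integrandJ, riemannZeta_one_sub_eq h0 h1, ← hD,
      show 2 * ((1 / 2 - δ : ℝ) : ℂ) - 1 + s = s - 2 * δ by push_cast; ring]
    ring
  have hA := norm_riemannZeta_mul_le (δ := δ) (η := η) ⟨hδ0, hδ1⟩ ⟨hη0, hη1⟩ hT (s := s)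
    ⟨by linarith, by linarith⟩ him
  have hχ := norm_zetaChi_le_of_large hT (s := s) ⟨by linarith, by linarith⟩ him
  rw [← hX] at hA hχ
  have hP := norm_dirichletPoly_le (a := 1 - 2 * (1 / 2 - δ)) (x := 1 + 2 * δ + η) hX0 (s := s)
    (by linarith) (by linarith) (by linarith)
  rw [← hD, show 1 + 2 * δ + η - (1 - 2 * (1 / 2 - δ)) - 1 = η by ring,
    show 1 + 2 * δ + η - 1 = 2 * δ + η by ring] at hP
  have hB : ‖zetaChi (1 - s) * D‖ ≤
      1.05 * ((1 + 1 / η) * (1 + 1 / (2 * δ + η)) * X ^ (1 / 2 + 2 * δ + η)) := by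
    have e1 : X ^ (s.re - 1 / 2) = X ^ s.re * X ^ (-(1 / 2) : ℝ) := by
      rw [← Real.rpow_add hX0]; congr 1
    have e2 : X ^ (1 / 2 + 2 * δ + η) = X ^ (1 + 2 * δ + η) * X ^ (-(1 / 2) : ℝ) := by
      rw [← Real.rpow_add hX0]; congr 1; ring
    rw [norm_mul, e2]
    rw [e1] at hχ
    calc ‖zetaChi (1 - s)‖ * ‖D‖ ≤ 1.05 * (X ^ s.re * X ^ (-(1 / 2) : ℝ)) * ‖D‖ := by gcongr
      _ = 1.05 * X ^ (-(1 / 2) : ℝ) * (X ^ s.re * ‖D‖) := by ring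
      _ ≤ 1.05 * X ^ (-(1 / 2) : ℝ) *
          (X ^ (1 + 2 * δ + η) * ((1 + 1 / η) * (1 + 1 / (2 * δ + η)))) := by gcongr
      _ = _ := by ring
  rw [hsplit]
  refine (norm_sub_le _ _).trans ((add_le_add hA hB).trans_eq ?_)
  ring

theorem norm_segmentIntegral_le {f : ℂ → ℂ} {a b : ℂ} {C : ℝ}
    (h : ∀ u ∈ Icc (0 : ℝ) 1, ‖f (a + (u : ℂ) * (b - a))‖ ≤ C) :
    ‖segmentIntegral f a b‖ ≤ ‖b - a‖ * C := by
  rw [segmentIntegral, norm_mul]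
  gcongr
  have := intervalIntegral.norm_integral_le_of_norm_le_const (a := (0 : ℝ)) (b := 1) (C := C)
    (f := fun u : ℝ => f (a + (u : ℂ) * (b - a))) fun u hu => by
      rw [uIoc_of_le zero_le_one] at hu
      exact h u ⟨hu.1.le, hu.2⟩
  simpa using this

/-- Half the length of the segment times the supremum bound for the integrand. -/
theorem norm_integralJ_le {τ δ η T X : ℝ} (hδτ : δ = 1 / 2 - τ) (hδ : δ ∈ Icc (0 : ℝ) (1 / 4))
    (hη : η ∈ Ioc (0 : ℝ) (33 / 100)) (hT : 100 ≤ T) (hX : X = T / (2 * π)) :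
    ‖integralJ₁ τ X η T‖ ≤ 1 / 2 * ((1 / 2 + δ + η) *
      (2.19 * ((1 + 1 / η) * (1 + 1 / (2 * δ + η)) * X ^ (1 / 2 + 2 * δ + η)))) ∧
    ‖integralJ₂ τ X η T‖ ≤ 1 / 2 * ((1 / 2 + δ + η) *
      (2.19 * ((1 + 1 / η) * (1 + 1 / (2 * δ + η)) * X ^ (1 / 2 + 2 * δ + η)))) := by
  have hI : ‖1 / (2 * I)‖ = 1 / 2 := by simp
  have hδ0 := hδ.1
  have hη0 := hη.1
  have hlen : |1 / 2 + δ + η| = 1 / 2 + δ + η := abs_of_pos (by linarith)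
  constructor
  · have e : ((2 - 2 * τ + η : ℝ) : ℂ) - I * T - (((1 - τ : ℝ) : ℂ) - I * T) =
        ((1 / 2 + δ + η : ℝ) : ℂ) := by
      rw [hδτ]; push_cast; ring
    rw [integralJ₁, norm_mul, hI]
    gcongr
    refine (norm_segmentIntegral_le fun u hu =>
      norm_integrandJ_le hδτ hδ hη hT hX ?_ ?_).trans_eq ?_
    · rw [e]
      simp only [add_re, sub_re, mul_re, I_re, I_im, ofReal_re, ofReal_im]
      constructor <;> nlinarith [hu.1, hu.2]
    · rw [e]
      simp [abs_of_nonneg (show 0 ≤ T by linarith)]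
    · rw [e, norm_real, Real.norm_eq_abs, hlen]
  · have e : ((1 - τ : ℝ) : ℂ) + I * T - (((2 - 2 * τ + η : ℝ) : ℂ) + I * T) =
        ((-(1 / 2 + δ + η) : ℝ) : ℂ) := by
      rw [hδτ]; push_cast; ring
    rw [integralJ₂, norm_mul, hI]
    gcongr
    refine (norm_segmentIntegral_le fun u hu =>
      norm_integrandJ_le hδτ hδ hη hT hX ?_ ?_).trans_eq ?_
    · rw [e]
      simp only [add_re, mul_re, I_re, I_im, ofReal_re, ofReal_im]
      constructor <;> nlinarith [hu.1, hu.2]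
    · rw [e]
      simp [abs_of_nonneg (show 0 ≤ T by linarith)]
    · rw [e, norm_real, Real.norm_eq_abs, abs_neg, hlen]

/-! ### Numerical bounds -/

theorem log_ge_of_hundred_le {T : ℝ} (hT : 100 ≤ T) : 4.57 ≤ Real.log T := by
  have h1 : Real.log 100 ≤ Real.log T := Real.log_le_log (by norm_num) hT
  -- `2 ^ 33 ≤ 100 ^ 5`
  have h2 : Real.log ((2 : ℝ) ^ 33) ≤ Real.log ((100 : ℝ) ^ 5) :=
    Real.log_le_log (by norm_num) (by norm_num)
  rw [Real.log_pow, Real.log_pow] at h2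
  push_cast at h2
  linarith [Real.log_two_gt_d9]

/-- Here `T ^ η = exp 1.501 < 4.487`, while `√(2π) > 2.506` and `(2π) ^ η ≥ 1 + 1.73 η`. -/
theorem rpow_div_two_pi_le {T δ η : ℝ} (hT : 100 ≤ T) (hδ : 0 ≤ δ)
    (hη : η = 1.501 / Real.log T) :
    (T / (2 * π)) ^ (1 / 2 + 2 * δ + η) ≤ 1.791 / (1 + 1.73 * η) * T ^ (1 / 2 + 2 * δ) := by
  have hT0 : 0 < T := by linarith
  have hL := log_ge_of_hundred_le hT
  have hη0 : 0 < η := by rw [hη]; positivity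
  have hpi : 3.1415 < π := Real.pi_gt_d4
  have h1 : T ^ η ≤ 4.487 := by
    rw [Real.rpow_def_of_pos hT0, hη, mul_div_cancel₀ _ (by linarith : Real.log T ≠ 0)]
    have h2 := Real.exp_bound' (x := 0.501) (by norm_num) (by norm_num) (n := 6) (by norm_num)
    have h3 : Real.exp 0.501 ≤ 1.6504 := by
      refine h2.trans ?_
      norm_num [Finset.sum_range_succ, Nat.factorial]
    rw [show (1.501 : ℝ) = 1 + 0.501 by norm_num, Real.exp_add]
    nlinarith [Real.exp_one_lt_d9, Real.exp_pos 1, Real.exp_pos 0.501]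
  have h2 : 2.506 ≤ (2 * π) ^ (1 / 2 : ℝ) := by
    rw [← Real.sqrt_eq_rpow]
    apply Real.le_sqrt_of_sq_le
    norm_num at hpi ⊢
    linarith
  have h3 : 1 + 1.73 * η ≤ (2 * π) ^ η := by
    rw [Real.rpow_def_of_pos (by positivity)]
    have h4 : 1.73 ≤ Real.log (2 * π) := by
      have h5 : Real.log ((2 : ℝ) ^ 5) ≤ Real.log ((2 * π) ^ 2) :=
        Real.log_le_log (by norm_num) (by nlinarith)
      rw [Real.log_pow, Real.log_pow] at h5
      push_cast at h5
      linarith [Real.log_two_gt_d9]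
    nlinarith [Real.add_one_le_exp (Real.log (2 * π) * η)]
  have h4 : 1 ≤ (2 * π) ^ (2 * δ) := Real.one_le_rpow (by linarith) (by linarith)
  have h5 : 2.506 * (1 + 1.73 * η) ≤ (2 * π) ^ (1 / 2 + 2 * δ + η) := by
    rw [Real.rpow_add (by positivity), Real.rpow_add (by positivity)]
    calc 2.506 * (1 + 1.73 * η) ≤ (2 * π) ^ (1 / 2 : ℝ) * 1 * (2 * π) ^ η := by
          rw [mul_one]; gcongr
      _ ≤ _ := by gcongr
  rw [Real.div_rpow hT0.le (by positivity), Real.rpow_add hT0]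
  calc T ^ (1 / 2 + 2 * δ) * T ^ η / (2 * π) ^ (1 / 2 + 2 * δ + η)
      ≤ T ^ (1 / 2 + 2 * δ) * 4.487 / (2.506 * (1 + 1.73 * η)) := by gcongr
    _ = (4.487 / 2.506) / (1 + 1.73 * η) * T ^ (1 / 2 + 2 * δ) := by field_simp
    _ ≤ _ := by gcongr; norm_num

/-- The numerical inequality for `τ = 1/2`, after division by `√T`; `1.791` is the constant of
`rpow_div_two_pi_le` and `2.19` that of `norm_integrandJ_le`. -/
theorem bound_central {η L : ℝ} (hη : η ∈ Ioc (0 : ℝ) (33 / 100)) (hL : L = 1.501 / η) :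
    1 / 2 * ((1 / 2 + 0 + η) * (2.19 * ((1 + 1 / η) * (1 + 1 / (2 * 0 + η)) *
      (1.791 / (1 + 1.73 * η))))) ≤ 0.47 * L ^ 2 + 2.825 * L := by
  obtain ⟨hη0, hη1⟩ := hη
  have e : 1 / 2 * ((1 / 2 + 0 + η) * (2.19 * ((1 + 1 / η) * (1 + 1 / (2 * 0 + η)) *
      (1.791 / (1 + 1.73 * η))))) =
      (1.961145 * (1 / 2 + η) * (1 + η) ^ 2) / (η ^ 2 * (1 + 1.73 * η)) := by
    rw [mul_zero, zero_add]
    field_simp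
    ring
  have e' : 0.47 * L ^ 2 + 2.825 * L = (0.47 * 1.501 ^ 2 + 2.825 * 1.501 * η) / η ^ 2 := by
    rw [hL]; field_simp
  rw [e, e', div_le_div_iff₀ (by positivity) (by positivity)]
  have h : 1.961145 * (1 / 2 + η) * (1 + η) ^ 2 ≤
      (0.47 * 1.501 ^ 2 + 2.825 * 1.501 * η) * (1 + 1.73 * η) := by
    nlinarith [mul_pos hη0 hη0]
  nlinarith [mul_le_mul_of_nonneg_right h (sq_nonneg η)]

/-- The numerical inequality for `δ = 1/2 - τ > 0`, after division by `T ^ (1/2 + 2δ)`. -/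
theorem bound_off_central {δ η L : ℝ} (hδ : δ ∈ Ioc (0 : ℝ) (1 / 4))
    (hη : η ∈ Ioc (0 : ℝ) (33 / 100)) (hL : L = 1.501 / η) :
    1 / 2 * ((1 / 2 + δ + η) * (2.19 * ((1 + 1 / η) * (1 + 1 / (2 * δ + η)) *
      (1.791 / (1 + 1.73 * η))))) ≤ (0.173 / δ ^ 2 + 6.76) * L := by
  obtain ⟨hη0, hη1⟩ := hη
  obtain ⟨hδ0, hδ1⟩ := hδ
  have h1 : 1 / 2 + δ + η ≤ 1.08 := by norm_num at *; linarith
  have h2 : (1 + 1 / η) * (1.791 / (1 + 1.73 * η)) ≤ 1.791 / η := by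
    rw [show (1 + 1 / η) * (1.791 / (1 + 1.73 * η)) =
      1.791 / η * ((1 + η) / (1 + 1.73 * η)) by field_simp; ring]
    refine mul_le_of_le_one_right (by positivity) (div_le_one_of_le₀ ?_ (by positivity))
    nlinarith
  have h3 : 1 + 1 / (2 * δ + η) ≤ 1 + 1 / (2 * δ) := by gcongr; linarith
  have h4 : 1.08 * 1.961145 * (1 + 1 / (2 * δ)) ≤ 1.501 * (0.173 / δ ^ 2 + 6.76) := by
    have hx : 1 / (2 * δ) = (1 / δ) / 2 := by field_simp
    have hx2 : 0.173 / δ ^ 2 = 0.173 * (1 / δ) ^ 2 := by field_simp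
    rw [hx, hx2]
    nlinarith [sq_nonneg (1 / δ - 2)]
  calc _ = 1 / 2 * ((1 / 2 + δ + η) * (2.19 * (((1 + 1 / η) * (1.791 / (1 + 1.73 * η))) *
        (1 + 1 / (2 * δ + η))))) := by ring
    _ ≤ 1 / 2 * (1.08 * (2.19 * ((1.791 / η) * (1 + 1 / (2 * δ))))) := by gcongr
    _ = 1.08 * 1.961145 * (1 + 1 / (2 * δ)) / η := by ring
    _ ≤ 1.501 * (0.173 / δ ^ 2 + 6.76) / η := by gcongr
    _ = _ := by rw [hL]; ring

end

theorem proposition3p2 (T X lam : ℝ) (hT : 100 ≤ T) (hX : X = T / (2 * Real.pi))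
    (hlam : lam = 1.501 / Real.log T) :
    (‖integralJ₁ (1 / 2) X lam T‖
        ≤ 0.47 * Real.sqrt T * Real.log T ^ 2 + 2.825 * Real.sqrt T * Real.log T ∧
      ‖integralJ₂ (1 / 2) X lam T‖
        ≤ 0.47 * Real.sqrt T * Real.log T ^ 2 + 2.825 * Real.sqrt T * Real.log T) ∧
    ∀ τ : ℝ, 1 / 4 ≤ τ → τ < 1 / 2 →
      ‖integralJ₁ τ X lam T‖
        ≤ (0.173 / (1 / 2 - τ) ^ 2 + 6.76) * T ^ (3 / 2 - 2 * τ) * Real.log T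
          + 0.1 * T ^ (1 - τ) * Real.log T ^ 2 ∧
      ‖integralJ₂ τ X lam T‖
        ≤ (0.173 / (1 / 2 - τ) ^ 2 + 6.76) * T ^ (3 / 2 - 2 * τ) * Real.log T
          + 0.1 * T ^ (1 - τ) * Real.log T ^ 2 := by
  have hT0 : 0 < T := by linarith
  have hL := log_ge_of_hundred_le hT
  have hL0 : 0 < Real.log T := by linarith
  have hlam0 : 0 < lam := by rw [hlam]; positivity
  have hlam' : lam ∈ Set.Ioc (0 : ℝ) (33 / 100) := by
    refine ⟨hlam0, ?_⟩
    rw [hlam, div_le_iff₀ hL0]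
    norm_num at hL ⊢
    linarith
  have hLlam : Real.log T = 1.501 / lam := by rw [hlam]; field_simp
  have main : ∀ δ : ℝ, 0 ≤ δ → δ ≤ 1 / 4 → ∀ C : ℝ,
      1 / 2 * ((1 / 2 + δ + lam) * (2.19 * ((1 + 1 / lam) * (1 + 1 / (2 * δ + lam)) *
        (1.791 / (1 + 1.73 * lam))))) ≤ C →
      1 / 2 * ((1 / 2 + δ + lam) * (2.19 * ((1 + 1 / lam) * (1 + 1 / (2 * δ + lam)) *
        X ^ (1 / 2 + 2 * δ + lam)))) ≤ C * T ^ (1 / 2 + 2 * δ) := by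
    intro δ hδ0 hδ1 C hC
    have h := rpow_div_two_pi_le hT hδ0 hlam
    rw [← hX] at h
    calc _ ≤ 1 / 2 * ((1 / 2 + δ + lam) * (2.19 * ((1 + 1 / lam) * (1 + 1 / (2 * δ + lam)) *
        (1.791 / (1 + 1.73 * lam) * T ^ (1 / 2 + 2 * δ))))) := by gcongr
      _ = 1 / 2 * ((1 / 2 + δ + lam) * (2.19 * ((1 + 1 / lam) * (1 + 1 / (2 * δ + lam)) *
        (1.791 / (1 + 1.73 * lam))))) * T ^ (1 / 2 + 2 * δ) := by ring
      _ ≤ _ := by gcongr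
  constructor
  · have hJ := norm_integralJ_le (τ := 1 / 2) (δ := 0) (by norm_num) ⟨le_rfl, by norm_num⟩
      hlam' hT hX
    have hm := main 0 le_rfl (by norm_num) _ (bound_central hlam' hLlam)
    have e : (0.47 * Real.log T ^ 2 + 2.825 * Real.log T) * T ^ (1 / 2 + 2 * 0 : ℝ) =
        0.47 * Real.sqrt T * Real.log T ^ 2 + 2.825 * Real.sqrt T * Real.log T := by
      rw [mul_zero, add_zero, ← Real.sqrt_eq_rpow]; ring
    rw [e] at hm
    exact ⟨hJ.1.trans hm, hJ.2.trans hm⟩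
  · intro τ hτ0 hτ1
    have hJ := norm_integralJ_le (τ := τ) (δ := 1 / 2 - τ) rfl ⟨by linarith, by linarith⟩
      hlam' hT hX
    have hm := main (1 / 2 - τ) (by linarith) (by linarith) _
      (bound_off_central (δ := 1 / 2 - τ) ⟨by linarith, by linarith⟩ hlam' hLlam)
    have e : (0.173 / (1 / 2 - τ) ^ 2 + 6.76) * Real.log T * T ^ (1 / 2 + 2 * (1 / 2 - τ)) ≤
        (0.173 / (1 / 2 - τ) ^ 2 + 6.76) * T ^ (3 / 2 - 2 * τ) * Real.log T
          + 0.1 * T ^ (1 - τ) * Real.log T ^ 2 := by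
      rw [show 1 / 2 + 2 * (1 / 2 - τ) = 3 / 2 - 2 * τ by ring]
      have : 0 ≤ 0.1 * T ^ (1 - τ) * Real.log T ^ 2 := by positivity
      linarith
    exact ⟨hJ.1.trans (hm.trans e), hJ.2.trans (hm.trans e)⟩
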